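/- Let $d\in[1,+\infty]$, let $D\subsetneq\mathbb C$ be a simply connected domain, and let $(\Phi_{s,t})_{0\le s\le t<+\infty}$ be a family of holomorphic self-maps $\Phi_{s,t}:D\to D$ such that - (EF1) $\Phi_{s,s}=\mathrm{id}_D$ for all $s\ge 0$; - (EF2) $\Phi_{s,t}=\Phi_{u,t}\circ\Phi_{s,u}$ whenever $0\le s\le u\le t<+\infty$. Let $\zeta_1,\zeta_2\in D$ with $\zeta_1\ne\zeta_2$. Suppose that the functions $t\mapsto\Phi_{0,t}(\zeta_1)$ and $t\mapsto\Phi_{0,t}(\zeta_2)$ belong to $AC^d([0,+\infty),D)$, i.e. they are functions from $[0,+\infty)$ to $D$ that are absolutely continuous on every compact subinterval of $[0,+\infty)$ and whose derivatives belong to $L^d_{\mathrm{loc}}([0,+\infty))$. Suppose also that $\Phi_{0,t}(\zeta_1)\ne\Phi_{0,t}(\zeta_2)$ for all $t\ge0$. Then $(\Phi_{s,t})$ is an evolution family of order $d$ (an $L^d$-evolution family) in $D$; that is, in addition to EF1 and EF2, the following holds: - (EF3) for any $T>0$ and any $z\in D$ there exists a non-negative function $k_{z,T}\in L^d([0,T],\mathbb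 R)$ such that $$|\Phi_{s,t}(z)-\Phi_{s,u}(z)|\le\int_u^t k_{z,T}(\xi)\,d\xi\qquad\text{whenever } 0\le s\le u\le t\le T.$$ -/

import Mathlib

open MeasureTheory Set
open scoped ENNReal

namespace Loewner

/-- The class `AC^d(X, Y)` for an interval `X ⊆ ℝ`, a set `Y ⊆ ℂ` and `d ∈ [1, ∞]`: functions
`f : X → Y` that are locally absolutely continuous on `X` (absolutely continuous on every compact
interval `[a, b] ⊆ X`), with derivative `f'` in `L^d_loc(X)`.  Only the values of `f` on `X` matter:
the interior points of `[a, b]` are interior points of `X`, and the end points form a null set. -/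
structure MemAC (d : ℝ≥0∞) (X : Set ℝ) (Y : Set ℂ) (f : ℝ → ℂ) : Prop where
  mapsTo : MapsTo f X Y
  absolutelyContinuous : ∀ a b : ℝ, a ≤ b → Icc a b ⊆ X → AbsolutelyContinuousOnInterval f a b
  memLp_deriv : ∀ a b : ℝ, a ≤ b → Icc a b ⊆ X → MemLp (deriv f) d (volume.restrict (Icc a b))

/-- `(Φ_{s,t})_{0 ≤ s ≤ t < ∞} ⊆ Hol(D, D)`: every `Φ s t` with `0 ≤ s ≤ t` restricts to a
holomorphic self-map of the open set `D`.  The values of `Φ` for other parameters, and outside `D`,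
are irrelevant. -/
def IsHolSelfMapFamily (D : Set ℂ) (Φ : ℝ → ℝ → ℂ → ℂ) : Prop :=
  ∀ s t : ℝ, 0 ≤ s → s ≤ t → DifferentiableOn ℂ (Φ s t) D ∧ MapsTo (Φ s t) D D

/-- EF1: `Φ_{s,s} = id_D`. -/
def EF1 (D : Set ℂ) (Φ : ℝ → ℝ → ℂ → ℂ) : Prop :=
  ∀ s : ℝ, 0 ≤ s → ∀ z ∈ D, Φ s s z = z

/-- EF2: `Φ_{s,t} = Φ_{u,t} ∘ Φ_{s,u}` whenever `0 ≤ s ≤ u ≤ t`. -/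
def EF2 (D : Set ℂ) (Φ : ℝ → ℝ → ℂ → ℂ) : Prop :=
  ∀ s u t : ℝ, 0 ≤ s → s ≤ u → u ≤ t → ∀ z ∈ D, Φ s t z = Φ u t (Φ s u z)

/-- EF3: for any `T > 0` and `z ∈ D` there is a non-negative `k ∈ L^d([0,T], ℝ)` such that
`|Φ_{s,t}(z) - Φ_{s,u}(z)| ≤ ∫_u^t k` whenever `0 ≤ s ≤ u ≤ t ≤ T`. -/
def EF3 (d : ℝ≥0∞) (D : Set ℂ) (Φ : ℝ → ℝ → ℂ → ℂ) : Prop :=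
  ∀ T : ℝ, 0 < T → ∀ z ∈ D, ∃ k : ℝ → ℝ,
    (∀ ξ ∈ Icc 0 T, 0 ≤ k ξ) ∧ MemLp k d (volume.restrict (Icc 0 T)) ∧
      ∀ s u t : ℝ, 0 ≤ s → s ≤ u → u ≤ t → t ≤ T →
        ‖Φ s t z - Φ s u z‖ ≤ ∫ ξ in u..t, k ξ

/-- `(Φ_{s,t})` is an evolution family of order `d ∈ [1, ∞]` (an `L^d`-evolution family) in the
domain `D ⊆ ℂ`. -/
structure IsEvolutionFamily (d : ℝ≥0∞) (D : Set ℂ) (Φ : ℝ → ℝ → ℂ → ℂ) : Prop where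
  hol : IsHolSelfMapFamily D Φ
  ef1 : EF1 D Φ
  ef2 : EF2 D Φ
  ef3 : EF3 d D Φ

end Loewner

namespace Loewner

/-! A holomorphic self-map of the disc that moves two distinct points little moves every point of a
compact set little, with a linear bound. Compose `φ` on both sides with disc automorphisms to get a
self-map `ψ` with `ψ 0 = 0`. By Schwarz, `1 - ψ(x)/x` has non-negative real part, so Harnack bounds
its size at any point of a compact subdisc by its size at one nonzero point. This is
`exists_norm_map_sub_le`.

The Riemann map, obtained here from Koebe's extremal problem, carries this to `D`. By EF2,
`Φ_{s,t}(z) - Φ_{s,u}(z)` is the displacement of `Φ_{s,u}(z)` under `Φ_{u,t}`, and that map also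
sends `Φ_{0,u}(ζᵢ)` to `Φ_{0,t}(ζᵢ)`. On `[0, T]` the two trajectories stay in a compact set and,
never colliding, at a positive distance from each other; Schwarz–Pick confines `Φ_{s,u}(z)` as well.
The constants are therefore uniform, and a multiple of the sum of the two speeds serves as `k` in
EF3. -/

open Metric Complex Filter Topology

/-! ### Disc automorphisms and the Schwarz–Pick lemma -/

/-- The disc automorphism `z ↦ (z - a) / (1 - ā z)` taking `a` to `0`. -/
noncomputable def mob (a z : ℂ) : ℂ := (z - a) / (1 - star a * z)

lemma one_sub_star_mul_ne_zero {a z : ℂ} (ha : ‖a‖ < 1) (hz : ‖z‖ < 1) : 1 - star a * z ≠ 0 := by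
  intro h
  have h1 : star a * z = 1 := (sub_eq_zero.mp h).symm
  have h2 : ‖a‖ * ‖z‖ = 1 := by rw [← norm_star a, ← norm_mul, h1, norm_one]
  nlinarith [norm_nonneg a, norm_nonneg z]

lemma mob_self (a : ℂ) : mob a a = 0 := by simp [mob]

lemma mob_zero_right (a : ℂ) : mob a 0 = -a := by simp [mob]

lemma norm_mob_lt_one {a z : ℂ} (ha : ‖a‖ < 1) (hz : ‖z‖ < 1) : ‖mob a z‖ < 1 := by
  have hne := one_sub_star_mul_ne_zero ha hz
  rw [mob, norm_div, div_lt_one (norm_pos_iff.mpr hne), ← sq_lt_sq₀ (norm_nonneg _) (norm_nonneg _)]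
  have ha' : ‖a‖ ^ 2 < 1 := by nlinarith [norm_nonneg a]
  have hz' : ‖z‖ ^ 2 < 1 := by nlinarith [norm_nonneg z]
  rw [Complex.sq_norm, Complex.normSq_apply] at *
  rw [Complex.sq_norm, Complex.normSq_apply] at *
  simp
  nlinarith [mul_pos (sub_pos.mpr ha') (sub_pos.mpr hz')]

lemma mob_neg_mob {a z : ℂ} (ha : ‖a‖ < 1) (hz : ‖z‖ < 1) : mob (-a) (mob a z) = z := by
  have hne := one_sub_star_mul_ne_zero ha hz
  have hne' := one_sub_star_mul_ne_zero (a := -a) (by simpa using ha) (norm_mob_lt_one ha hz)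
  rw [mob, div_eq_iff hne']
  have h : mob a z * (1 - star a * z) = z - a := div_mul_cancel₀ _ hne
  rw [star_neg]
  linear_combination h

lemma mapsTo_mob {a : ℂ} (ha : ‖a‖ < 1) : MapsTo (mob a) (ball 0 1) (ball 0 1) := by
  intro z hz
  rw [mem_ball_zero_iff] at *
  exact norm_mob_lt_one ha hz

lemma differentiableOn_mob {a : ℂ} (ha : ‖a‖ < 1) : DifferentiableOn ℂ (mob a) (ball 0 1) := by
  intro z hz
  have hne := one_sub_star_mul_ne_zero ha (mem_ball_zero_iff.mp hz)
  exact DifferentiableAt.differentiableWithinAt (by unfold mob; fun_prop (disch := exact hne))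

lemma contDiffOn_mob : ContDiffOn ℝ 1 (fun p : ℂ × ℂ => mob p.1 p.2) (ball 0 1 ×ˢ ball 0 1) := by
  unfold mob
  simp only [div_eq_mul_inv]
  refine (contDiff_snd.sub contDiff_fst).contDiffOn.mul (ContDiffOn.inv ?_ ?_)
  · refine contDiffOn_const.sub (ContDiffOn.mul ?_ contDiffOn_snd)
    exact (Complex.conjCLE.contDiff.comp contDiff_fst).contDiffOn
  · rintro ⟨a, z⟩ ⟨ha, hz⟩
    exact one_sub_star_mul_ne_zero (mem_ball_zero_iff.mp ha) (mem_ball_zero_iff.mp hz)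

lemma closedBall_prod_subset {r : ℝ} (hr : r < 1) :
    (closedBall (0 : ℂ) r ×ˢ closedBall (0 : ℂ) r) ⊆ ball 0 1 ×ˢ ball 0 1 :=
  prod_mono (closedBall_subset_ball hr) (closedBall_subset_ball hr)

lemma exists_norm_mob_le {r : ℝ} (hr0 : 0 ≤ r) (hr : r < 1) :
    ∃ ρ, r ≤ ρ ∧ ρ < 1 ∧ ∀ a z : ℂ, ‖a‖ ≤ r → ‖z‖ ≤ r → ‖mob a z‖ ≤ ρ := by
  have hK : IsCompact (closedBall (0 : ℂ) r ×ˢ closedBall (0 : ℂ) r) :=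
    (isCompact_closedBall _ _).prod (isCompact_closedBall _ _)
  obtain ⟨p, hp, hmax⟩ := hK.exists_isMaxOn ⟨(0, 0), by simp [hr0]⟩
    (contDiffOn_mob.continuousOn.mono (closedBall_prod_subset hr)).norm
  have hp' := closedBall_prod_subset hr hp
  refine ⟨max r ‖mob p.1 p.2‖, le_max_left _ _, max_lt hr ?_, fun a z ha hz => ?_⟩
  · exact norm_mob_lt_one (mem_ball_zero_iff.mp hp'.1) (mem_ball_zero_iff.mp hp'.2)
  · exact le_max_of_le_right (hmax (a := (a, z)) (by simp [ha, hz]))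

lemma exists_norm_mob_sub_le {r : ℝ} (hr : r < 1) :
    ∃ L : ℝ, 0 ≤ L ∧ ∀ a z a' z' : ℂ, ‖a‖ ≤ r → ‖z‖ ≤ r → ‖a'‖ ≤ r → ‖z'‖ ≤ r →
      ‖mob a z - mob a' z'‖ ≤ L * (‖a - a'‖ + ‖z - z'‖) := by
  have hK : IsCompact (closedBall (0 : ℂ) r ×ˢ closedBall (0 : ℂ) r) :=
    (isCompact_closedBall _ _).prod (isCompact_closedBall _ _)
  obtain ⟨K, hL⟩ := (contDiffOn_mob.mono (closedBall_prod_subset hr)).exists_lipschitzOnWith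
    one_ne_zero ((convex_closedBall _ _).prod (convex_closedBall _ _)) hK
  refine ⟨K, K.2, fun a z a' z' ha hz ha' hz' => ?_⟩
  have := hL.dist_le_mul (a, z) (by simp [ha, hz]) (a', z') (by simp [ha', hz'])
  rw [dist_eq_norm, Prod.dist_eq, dist_eq_norm, dist_eq_norm] at this
  refine this.trans (mul_le_mul_of_nonneg_left ?_ K.2)
  exact max_le (le_add_of_nonneg_right (norm_nonneg _)) (le_add_of_nonneg_left (norm_nonneg _))

lemma half_norm_sub_le_norm_mob {a z : ℂ} (ha : ‖a‖ < 1) (hz : ‖z‖ < 1) :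
    ‖z - a‖ / 2 ≤ ‖mob a z‖ := by
  have hne := norm_pos_iff.mpr (one_sub_star_mul_ne_zero ha hz)
  rw [mob, norm_div]
  refine div_le_div_of_nonneg_left (norm_nonneg _) hne ?_
  calc ‖1 - star a * z‖ ≤ ‖(1 : ℂ)‖ + ‖star a * z‖ := norm_sub_le _ _
    _ ≤ 1 + 1 * 1 := by
      rw [norm_one, norm_mul, norm_star]
      gcongr
    _ = 2 := by norm_num

/-- Normalisation to a fixed origin, so that the Schwarz lemma applies: conjugate by the
automorphisms centred at `a` and at `φ a`. -/
lemma mob_comp_self_map {φ : ℂ → ℂ} (hd : DifferentiableOn ℂ φ (ball 0 1))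
    (hm : MapsTo φ (ball 0 1) (ball 0 1)) {a : ℂ} (ha : ‖a‖ < 1) :
    ∃ ψ : ℂ → ℂ, DifferentiableOn ℂ ψ (ball 0 1) ∧ MapsTo ψ (ball 0 1) (ball 0 1) ∧ ψ 0 = 0 ∧
      ∀ z, ‖z‖ < 1 → ψ (mob a z) = mob (φ a) (φ z) := by
  have hA : ‖φ a‖ < 1 := mem_ball_zero_iff.mp (hm (mem_ball_zero_iff.mpr ha))
  have ha' : ‖-a‖ < 1 := by simpa using ha
  refine ⟨fun w => mob (φ a) (φ (mob (-a) w)), ?_, ?_, ?_, fun z hz => ?_⟩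
  · exact (differentiableOn_mob hA).comp (hd.comp (differentiableOn_mob ha') (mapsTo_mob ha'))
      (hm.comp (mapsTo_mob ha'))
  · exact (mapsTo_mob hA).comp (hm.comp (mapsTo_mob ha'))
  · simp [mob_zero_right, mob_self]
  · simp only [mob_neg_mob ha hz]

/-- The Schwarz–Pick lemma. -/
lemma norm_mob_map_le {φ : ℂ → ℂ} (hd : DifferentiableOn ℂ φ (ball 0 1))
    (hm : MapsTo φ (ball 0 1) (ball 0 1)) {a z : ℂ} (ha : ‖a‖ < 1) (hz : ‖z‖ < 1) :
    ‖mob (φ a) (φ z)‖ ≤ ‖mob a z‖ := by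
  obtain ⟨ψ, hψd, hψm, hψ0, hψ⟩ := mob_comp_self_map hd hm ha
  rw [← hψ z hz]
  exact Complex.norm_le_norm_of_mapsTo_ball hψd
    (hψm.mono_right ball_subset_closedBall) hψ0 (norm_mob_lt_one ha hz)

/-- By Schwarz–Pick, `φ z` is no further from `φ a` in the pseudo-hyperbolic distance than `z` is
from `a`. The bound `ρ` depends on `r` alone, not on `φ`. -/
lemma exists_norm_map_le {r : ℝ} (hr0 : 0 ≤ r) (hr : r < 1) :
    ∃ ρ, r ≤ ρ ∧ ρ < 1 ∧ ∀ φ : ℂ → ℂ, DifferentiableOn ℂ φ (ball 0 1) →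
      MapsTo φ (ball 0 1) (ball 0 1) → ∀ a z : ℂ, ‖a‖ ≤ r → ‖φ a‖ ≤ r → ‖z‖ ≤ r → ‖φ z‖ ≤ ρ := by
  obtain ⟨ρ, hρ, hρ1, hb⟩ := exists_norm_mob_le hr0 hr
  obtain ⟨σ, hσ, hσ1, hb'⟩ := exists_norm_mob_le (hr0.trans hρ) hρ1
  refine ⟨σ, hρ.trans hσ, hσ1, fun φ hd hm a z ha hA hz => ?_⟩
  have hz1 := hz.trans_lt hr
  have hφz : ‖φ z‖ < 1 := mem_ball_zero_iff.mp (hm (mem_ball_zero_iff.mpr hz1))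
  rw [← mob_neg_mob (hA.trans_lt hr) hφz]
  refine hb' _ _ (by simpa using hA.trans hρ) ?_
  exact (norm_mob_map_le hd hm (ha.trans_lt hr) hz1).trans (hb _ _ ha hz)

/-! ### Harnack's inequality and displacement estimates -/

/-- Harnack's inequality for functions with non-negative real part, centred at the origin. -/
lemma norm_le_of_re_nonneg {p : ℂ → ℂ} (hd : DifferentiableOn ℂ p (ball 0 1))
    (hp : ∀ z ∈ ball (0 : ℂ) 1, 0 ≤ (p z).re) {z : ℂ} (hz : ‖z‖ < 1) :
    ‖p z‖ ≤ ‖p 0‖ * (1 + ‖z‖) / (1 - ‖z‖) := by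
  -- Borel–Carathéodory for `-p` needs a strictly positive bound `M` on the real part; `M` then
  -- tends to `0`.
  have h : ∀ M : ℝ, 0 < M →
      ‖p z‖ ≤ 2 * M * ‖z‖ / (1 - ‖z‖) + ‖p 0‖ * (1 + ‖z‖) / (1 - ‖z‖) := by
    intro M hM
    have := Complex.borelCaratheodory (f := fun z => -p z) hM hd.neg
      (fun w hw => by simpa using (neg_nonpos.mpr (hp w hw)).trans hM.le) one_pos
      (mem_ball_zero_iff.mpr hz)
    simpa using this
  have : Continuous fun M : ℝ =>
      2 * M * ‖z‖ / (1 - ‖z‖) + ‖p 0‖ * (1 + ‖z‖) / (1 - ‖z‖) := by fun_prop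
  have ht := (this.tendsto 0).mono_left (nhdsWithin_le_nhds (s := Ioi 0))
  simp only [mul_zero, zero_mul, zero_div, zero_add] at ht
  exact ge_of_tendsto ht (eventually_mem_nhdsWithin.mono h)

/-- An automorphism moves `w` to the origin, which reduces to the centred inequality. -/
lemma exists_harnack {r : ℝ} (hr0 : 0 ≤ r) (hr : r < 1) :
    ∃ C : ℝ, 0 ≤ C ∧ ∀ p : ℂ → ℂ, DifferentiableOn ℂ p (ball 0 1) →
      (∀ z ∈ ball (0 : ℂ) 1, 0 ≤ (p z).re) → ∀ z w : ℂ, ‖z‖ ≤ r → ‖w‖ ≤ r →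
      ‖p z‖ ≤ C * ‖p w‖ := by
  obtain ⟨ρ, hρ, hρ1, hb⟩ := exists_norm_mob_le hr0 hr
  have hρ0 := hr0.trans hρ
  refine ⟨(1 + ρ) / (1 - ρ), div_nonneg (by linarith) (by linarith),
    fun p hd hp z w hz hw => ?_⟩
  have hw1 := hw.trans_lt hr
  have hw1' : ‖-w‖ < 1 := by simpa using hw1
  have hz1 := hz.trans_lt hr
  have h := norm_le_of_re_nonneg (p := p ∘ mob (-w))
    (hd.comp (differentiableOn_mob hw1') (mapsTo_mob hw1'))
    (fun x hx => hp _ (mapsTo_mob hw1' hx)) (norm_mob_lt_one hw1 hz1)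
  simp only [Function.comp_apply, mob_neg_mob hw1 hz1, mob_zero_right, neg_neg] at h
  have hmz := hb w z hw hz
  calc ‖p z‖ ≤ _ := h
    _ ≤ ‖p w‖ * (1 + ρ) / (1 - ρ) := by
      gcongr
    _ = _ := by ring

/-- A holomorphic self-map of the disc fixing the origin and almost fixing a point `w` is close
to the identity. -/
lemma exists_norm_sub_le_of_map_zero {r : ℝ} (hr0 : 0 ≤ r) (hr : r < 1) :
    ∃ C : ℝ, 0 ≤ C ∧ ∀ ψ : ℂ → ℂ, DifferentiableOn ℂ ψ (ball 0 1) →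
      MapsTo ψ (ball 0 1) (ball 0 1) → ψ 0 = 0 → ∀ z w : ℂ, ‖z‖ ≤ r → ‖w‖ ≤ r → w ≠ 0 →
      ‖ψ z - z‖ ≤ C * (‖ψ w - w‖ / ‖w‖) := by
  obtain ⟨C, hC, hH⟩ := exists_harnack hr0 hr
  refine ⟨C, hC, fun ψ hd hm h0 z w hz hw hw0 => ?_⟩
  -- `dslope ψ 0` is `ψ x / x` with its singularity at `0` removed. Schwarz bounds it by `1`, so
  -- Harnack applies to `1 - dslope ψ 0`, which is the displacement divided by `-x`.
  have hg : DifferentiableOn ℂ (dslope ψ 0) (ball 0 1) :=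
    (Complex.differentiableOn_dslope (ball_mem_nhds _ one_pos)).mpr hd
  have hmul : ∀ x, ψ x - x = -(x * (1 - dslope ψ 0 x)) := by
    intro x
    have := sub_smul_dslope ψ 0 x
    simp only [sub_zero, h0, smul_eq_mul] at this
    rw [← this]; ring
  have h1 : ∀ x ∈ ball (0 : ℂ) 1, 0 ≤ (1 - dslope ψ 0 x).re := by
    intro x hx
    have hb := Complex.norm_dslope_le_div_of_mapsTo_ball hd (R₂ := 1)
      (by rw [h0]; exact hm.mono_right ball_subset_closedBall) hx
    have := (Complex.re_le_norm _).trans hb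
    simp only [Complex.sub_re, Complex.one_re]
    linarith [div_one (1 : ℝ)]
  have := hH (fun x => 1 - dslope ψ 0 x) (hg.const_sub 1) h1 z w hz hw
  rw [hmul, hmul, norm_neg, norm_neg, norm_mul, norm_mul,
    mul_div_cancel_left₀ _ (norm_ne_zero_iff.mpr hw0)]
  calc ‖z‖ * ‖1 - dslope ψ 0 z‖ ≤ 1 * ‖1 - dslope ψ 0 z‖ := by
        gcongr; linarith
    _ ≤ _ := by rw [one_mul]; exact this

/-- A holomorphic self-map of the disc that moves two points little moves every point little. -/
theorem exists_norm_map_sub_le {r δ : ℝ} (hr0 : 0 ≤ r) (hr : r < 1) (hδ : 0 < δ) :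
    ∃ C : ℝ, 0 ≤ C ∧ ∀ φ : ℂ → ℂ, DifferentiableOn ℂ φ (ball 0 1) →
      MapsTo φ (ball 0 1) (ball 0 1) → ∀ a b z : ℂ, ‖a‖ ≤ r → ‖b‖ ≤ r → ‖z‖ ≤ r →
      ‖φ a‖ ≤ r → ‖φ b‖ ≤ r → δ ≤ ‖b - a‖ →
      ‖φ z - z‖ ≤ C * (‖φ a - a‖ + ‖φ b - b‖) := by
  obtain ⟨ρ, hρ, hρ1, hb⟩ := exists_norm_mob_le hr0 hr
  obtain ⟨C, hC, hψC⟩ := exists_norm_sub_le_of_map_zero (hr0.trans hρ) hρ1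
  obtain ⟨L, hL, hLip⟩ := exists_norm_mob_sub_le hρ1
  -- The inner `L` bounds the displacement of `ψ` at `mob a b`, a point of norm at least `δ / 2`;
  -- `C` carries it to `mob a z`; the outer `L` undoes the automorphisms.
  refine ⟨L * (1 + C * (L / (δ / 2))), by positivity,
    fun φ hd hm a b z ha hb' hz hA hB hab => ?_⟩
  have ha1 := ha.trans_lt hr
  have hb1 := hb'.trans_lt hr
  have hz1 := hz.trans_lt hr
  have hφz : ‖φ z‖ < 1 := mem_ball_zero_iff.mp (hm (mem_ball_zero_iff.mpr hz1))
  obtain ⟨ψ, hψd, hψm, hψ0, hψ⟩ := mob_comp_self_map hd hm ha1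
  set w := mob a z
  set w₀ := mob a b
  have hw₀ : δ / 2 ≤ ‖w₀‖ := (by linarith : δ / 2 ≤ ‖b - a‖ / 2).trans
    (half_norm_sub_le_norm_mob ha1 hb1)
  have hw : ‖w‖ ≤ ρ := hb _ _ ha hz
  have key := hψC ψ hψd hψm hψ0 w w₀ hw (hb _ _ ha hb')
    (norm_pos_iff.mp ((half_pos hδ).trans_le hw₀))
  have h1 : ‖ψ w₀ - w₀‖ ≤ L * (‖φ a - a‖ + ‖φ b - b‖) := by
    rw [hψ b hb1]
    exact hLip _ _ _ _ (hA.trans hρ) (hB.trans hρ) (ha.trans hρ) (hb'.trans hρ)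
  have h2 : ‖ψ w₀ - w₀‖ / ‖w₀‖ ≤ L * (‖φ a - a‖ + ‖φ b - b‖) / (δ / 2) := by gcongr
  have hψw : ‖ψ w‖ ≤ ρ := (Complex.norm_le_norm_of_mapsTo_ball hψd
    (hψm.mono_right ball_subset_closedBall) hψ0 (hw.trans_lt hρ1)).trans hw
  have h3 : ‖φ z - z‖ ≤ L * (‖φ a - a‖ + ‖ψ w - w‖) := by
    have e1 : mob (-φ a) (ψ w) = φ z := by rw [hψ z hz1, mob_neg_mob (hA.trans_lt hr) hφz]
    have e2 : mob (-a) w = z := mob_neg_mob ha1 hz1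
    have := hLip (-φ a) (ψ w) (-a) w (by simpa using hA.trans hρ) hψw
      (by simpa using ha.trans hρ) hw
    rwa [e1, e2, neg_sub_neg, norm_sub_rev a] at this
  calc ‖φ z - z‖ ≤ L * (‖φ a - a‖ + ‖ψ w - w‖) := h3
    _ ≤ L * ((‖φ a - a‖ + ‖φ b - b‖)
          + C * (L * (‖φ a - a‖ + ‖φ b - b‖) / (δ / 2))) := by
      gcongr
      · exact le_add_of_nonneg_right (norm_nonneg _)
      · exact key.trans (by gcongr)
    _ = _ := by ring

/-! ### Montel's and Hurwitz's theorems -/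

/-- **Montel's theorem** in ultrafilter form. -/
theorem exists_tendstoLocallyUniformlyOn {ι : Type*} (l : Ultrafilter ι) {U : Set ℂ}
    (hU : IsOpen U) {f : ι → ℂ → ℂ} (hd : ∀ i, DifferentiableOn ℂ (f i) U)
    (hb : ∀ i, MapsTo (f i) U (closedBall 0 1)) :
    ∃ g : ℂ → ℂ, TendstoLocallyUniformlyOn f g l U := by
  have hlim : ∀ z, ∃ w, z ∈ U → Tendsto (fun i => f i z) l (𝓝 w) := by
    intro z
    by_cases hz : z ∈ U
    · obtain ⟨w, -, hw⟩ := (isCompact_closedBall (0 : ℂ) 1).ultrafilter_le_nhds'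
        (l.map fun i => f i z) (Filter.mem_map.mpr (Eventually.of_forall fun i => hb i hz))
      exact ⟨w, fun _ => hw⟩
    · exact ⟨0, fun h => absurd h hz⟩
  choose g hg using hlim
  refine ⟨g, Metric.tendstoLocallyUniformlyOn_iff.mpr fun ε hε z hz => ?_⟩
  obtain ⟨R, hR, hRU⟩ := Metric.isOpen_iff.mp hU z hz
  -- Each `f i` maps `ball z R` into a disc of radius `2` about `f i z`, so Schwarz gives the rate
  -- `2 / R`, hence variation at most `ε / 4` on this ball.
  refine ⟨ball z (min R (ε * R / 8)),
    mem_nhdsWithin_of_mem_nhds (ball_mem_nhds _ (by positivity)), ?_⟩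
  have hlip : ∀ w ∈ ball z (min R (ε * R / 8)), ∀ i, dist (f i w) (f i z) ≤ ε / 4 := by
    intro w hw i
    rw [mem_ball, lt_min_iff] at hw
    have hmaps : MapsTo (f i) (ball z R) (closedBall (f i z) 2) := by
      intro x hx
      have h1 := hb i (hRU hx)
      have h2 := hb i hz
      rw [mem_closedBall] at *
      linarith [dist_triangle_right (f i x) (f i z) 0]
    refine (dist_le_div_mul_dist_of_mapsTo_ball ((hd i).mono hRU) hmaps hw.1).trans ?_
    calc 2 / R * dist w z ≤ 2 / R * (ε * R / 8) := by gcongr; exact hw.2.le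
      _ = ε / 4 := by field_simp; norm_num
  filter_upwards [Metric.tendsto_nhds.mp (hg z hz) (ε / 4) (by positivity)] with i hi w hw
  have hwU : w ∈ U := hRU (ball_subset_ball (min_le_left _ _) hw)
  have hgw : dist (g w) (g z) ≤ ε / 4 :=
    le_of_tendsto ((hg w hwU).dist (hg z hz)) (Eventually.of_forall (hlip w hw))
  calc dist (g w) (f i w) ≤ dist (g w) (g z) + dist (g z) (f i z) + dist (f i z) (f i w) :=
        dist_triangle4 _ _ _ _
    _ ≤ ε / 4 + dist (g z) (f i z) + ε / 4 := by
        gcongr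
        rw [dist_comm]; exact hlip w hw i
    _ < ε := by rw [dist_comm] at hi; linarith

/-- **Hurwitz's theorem**: an isolated zero of a locally uniform limit of holomorphic functions
is approximated by zeros of these functions. -/
theorem eventually_exists_zero {ι : Type*} {l : Filter ι} {U : Set ℂ} (hU : IsOpen U)
    {f : ι → ℂ → ℂ} {g : ℂ → ℂ} (hd : ∀ i, DifferentiableOn ℂ (f i) U)
    (hgc : ContinuousOn g U) (hfg : TendstoLocallyUniformlyOn f g l U) {z₀ : ℂ} (hz₀ : z₀ ∈ U)
    (h0 : g z₀ = 0) (hne : ∀ᶠ z in 𝓝[≠] z₀, g z ≠ 0) :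
    ∀ᶠ i in l, ∃ z ∈ U, f i z = 0 := by
  obtain ⟨R, hR, hRs⟩ := Metric.mem_nhds_iff.mp
    (Filter.inter_mem (hU.mem_nhds hz₀) (eventually_nhdsWithin_iff.mp hne))
  have hR2 : 0 < R / 2 := half_pos hR
  have hsub : closedBall z₀ (R / 2) ⊆ U := fun z hz =>
    (hRs (closedBall_subset_ball (half_lt_self hR) hz)).1
  have hsne : ∀ z ∈ sphere z₀ (R / 2), g z ≠ 0 := fun z hz =>
    (hRs (sphere_subset_closedBall.trans (closedBall_subset_ball (half_lt_self hR)) hz)).2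
      (ne_of_mem_sphere hz hR2.ne')
  obtain ⟨x, hx, hmin⟩ := (isCompact_sphere z₀ (R / 2)).exists_isMinOn
    (NormedSpace.sphere_nonempty.mpr hR2.le)
    (hgc.mono (sphere_subset_closedBall.trans hsub)).norm
  have hm : 0 < ‖g x‖ := norm_pos_iff.mpr (hsne x hx)
  have hunif := (tendstoLocallyUniformlyOn_iff_forall_isCompact hU).mp hfg _ hsub
    (isCompact_closedBall _ _)
  -- With error below `‖g x‖ / 4`, `f i` differs from `f i z₀` by at least `‖g x‖ / 2` on the
  -- circle. The quantitative open mapping theorem then covers the disc of radius `‖g x‖ / 4` about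
  -- `f i z₀`, which contains `0`.
  filter_upwards [Metric.tendstoUniformlyOn_iff.mp hunif (‖g x‖ / 4) (by positivity)] with i hi
  have hc := hi z₀ (mem_closedBall_self hR2.le)
  rw [h0, dist_zero_left] at hc
  have hs : ∀ z ∈ sphere z₀ (R / 2), ‖g x‖ / 2 ≤ ‖f i z - f i z₀‖ := by
    intro z hz
    have h1 := hi z (sphere_subset_closedBall hz)
    have h2 : ‖g x‖ ≤ ‖g z‖ := hmin hz
    rw [dist_eq_norm] at h1
    have h3 : ‖g z‖ ≤ ‖g z - f i z‖ + ‖f i z - f i z₀‖ + ‖f i z₀‖ := by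
      calc ‖g z‖ = ‖(g z - f i z) + (f i z - f i z₀) + f i z₀‖ := by congr 1; ring
        _ ≤ _ := norm_add₃_le
    linarith
  have hfr : ∃ᶠ z in 𝓝 z₀, f i z ≠ f i z₀ := by
    by_contra hcon
    rw [not_frequently] at hcon
    have han : AnalyticOnNhd ℂ (f i) (ball z₀ R) :=
      ((hd i).mono fun z hz => (hRs hz).1).analyticOnNhd isOpen_ball
    have heq := han.eqOn_of_preconnected_of_eventuallyEq analyticOnNhd_const
      (convex_ball _ _).isPreconnected (mem_ball_self hR)
      (hcon.mono fun z hz => not_not.mp hz)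
    have h1 := hs x hx
    rw [heq (sphere_subset_closedBall.trans (closedBall_subset_ball (half_lt_self hR)) hx)] at h1
    simp only [sub_self, norm_zero] at h1
    linarith
  obtain ⟨z, hz, hfz⟩ := DiffContOnCl.ball_subset_image_closedBall
    ((hd i).diffContOnCl_ball hsub) hR2 hs hfr
    (show (0 : ℂ) ∈ _ by rw [mem_ball, dist_zero_left]; linarith)
  exact ⟨z, hsub hz, hfz⟩

/-! ### The Riemann mapping theorem -/

/-- The injective holomorphic maps from `U` to the unit disc taking `z₀` to `0`. -/
structure IsUnivalentToDisc (U : Set ℂ) (z₀ : ℂ) (f : ℂ → ℂ) : Prop where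
  mapsTo : MapsTo f U (ball 0 1)
  injOn : InjOn f U
  deriv_ne_zero : ∀ z ∈ U, deriv f z ≠ 0
  map_base : f z₀ = 0

namespace IsUnivalentToDisc

variable {U : Set ℂ} {z₀ : ℂ} {f : ℂ → ℂ}

/-- `deriv` is `0` where a function is not differentiable, so a nonvanishing `deriv` already encodes
holomorphy. -/
lemma differentiableOn (hf : IsUnivalentToDisc U z₀ f) : DifferentiableOn ℂ f U := fun z hz =>
  (differentiableAt_of_deriv_ne_zero (hf.deriv_ne_zero z hz)).differentiableWithinAt

end IsUnivalentToDisc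

/-- A continuous square root of a holomorphic function without zeros is holomorphic. -/
lemma differentiableAt_of_sq_eq {U : Set ℂ} (hU : IsOpen U) {s h : ℂ → ℂ}
    (hs : ContinuousOn s U) (hsq : ∀ z ∈ U, s z ^ 2 = h z) {z : ℂ} (hz : z ∈ U) (hne : h z ≠ 0)
    (hd : DifferentiableAt ℂ h z) : DifferentiableAt ℂ s z := by
  have hsz : s z ≠ 0 := fun h0 => hne (by rw [← hsq z hz, h0]; simp)
  have hsc : Tendsto s (𝓝 z) (𝓝 (s z)) := hs.continuousAt (hU.mem_nhds hz)
  have hsum : Tendsto (fun w => s w + s z) (𝓝 z) (𝓝 (s z + s z)) := hsc.add_const _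
  have hss : s z + s z ≠ 0 := by simpa [← two_mul] using hsz
  have hslope := hasDerivAt_iff_tendsto_slope.mp hd.hasDerivAt
  suffices HasDerivAt s (deriv h z / (s z + s z)) z from this.differentiableAt
  rw [hasDerivAt_iff_tendsto_slope]
  -- Since `s w ^ 2 - s z ^ 2 = (s w - s z) * (s w + s z)`, the slope of `s` is that of `h` divided
  -- by `s w + s z`.
  refine (hslope.div (hsum.mono_left nhdsWithin_le_nhds) hss).congr' ?_
  filter_upwards [nhdsWithin_le_nhds (hsum.eventually_ne hss),
    nhdsWithin_le_nhds (hU.mem_nhds hz)] with w hw hwU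
  simp only [slope_def_field, Pi.div_apply]
  rw [← hsq w hwU, ← hsq z hz]
  rw [div_div, mul_comm, ← div_div]
  congr 1
  rw [div_eq_iff hw]
  ring

/-- Take a square root `s` of `z - a` with `a` outside `U`. The images of `U` under `s` and `-s` are
disjoint, so `s` avoids a disc about `-s x`, and inverting in that disc bounds it. -/
lemma exists_mapsTo_ball_injOn_deriv_ne_zero {U : Set ℂ} (hUo : IsOpen U)
    (hUc : IsSimplyConnected U) (hU : U ≠ univ) :
    ∃ f : ℂ → ℂ, MapsTo f U (ball 0 1) ∧ InjOn f U ∧ ∀ z ∈ U, deriv f z ≠ 0 := by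
  obtain ⟨a, ha⟩ := (ne_univ_iff_exists_notMem U).mp hU
  have hne : ∀ z ∈ U, z - a ≠ 0 := fun z hz h => ha (sub_eq_zero.mp h ▸ hz)
  obtain ⟨s, hsc, hsq⟩ := exists_continuousOn_pow_eq hUc hUo
    (g := fun z => z - a) (by fun_prop) (by rintro ⟨z, hz, h⟩; exact hne z hz h) two_ne_zero
  have hsd : ∀ z ∈ U, DifferentiableAt ℂ s z := fun z hz =>
    differentiableAt_of_sq_eq hUo hsc (fun w _ => hsq w) hz (hne z hz) (by fun_prop)
  have hsinj : Function.Injective s := by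
    intro z w h
    have := hsq z
    rw [h, hsq w] at this
    exact (sub_left_injective this).symm
  have hsder : ∀ z ∈ U, deriv s z ≠ 0 := by
    intro z hz h
    have h1 := (hsd z hz).hasDerivAt.fun_pow 2
    simp only [hsq] at h1
    have h2 := h1.unique ((hasDerivAt_id z).sub_const a)
    simp [h] at h2
  obtain ⟨x, hx⟩ := hUc.nonempty
  have hnhds : s '' U ∈ 𝓝 (s x) := by
    have hstrict : HasStrictDerivAt s (deriv s x) x :=
      (DifferentiableOn.analyticAt (fun z hz => (hsd z hz).differentiableWithinAt)
        (hUo.mem_nhds hx)).hasStrictDerivAt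
    rw [← hstrict.map_nhds_eq (hsder x hx)]
    exact Filter.image_mem_map (hUo.mem_nhds hx)
  obtain ⟨ε, hε, hball⟩ := Metric.mem_nhds_iff.mp hnhds
  have hfar : ∀ z ∈ U, ε ≤ ‖s z + s x‖ := by
    intro z hz
    by_contra! hlt
    obtain ⟨w, hw, hwz⟩ := hball (show -s z ∈ ball (s x) ε by
      rw [mem_ball, dist_eq_norm, ← norm_neg]
      simpa [add_comm] using hlt)
    have hwz' : w = z := by
      have h1 := hsq w
      rw [hwz, neg_sq, hsq z] at h1
      exact (sub_left_injective h1).symm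
    subst hwz'
    apply hne w hw
    have : s w = 0 := by linear_combination hwz / 2
    rw [← hsq w, this]
    simp
  have hε' : (ε / 2 : ℂ) ≠ 0 := by simpa using hε.ne'
  have hden : ∀ z ∈ U, s z + s x ≠ 0 := fun z hz => norm_pos_iff.mp (hε.trans_le (hfar z hz))
  refine ⟨fun z => (ε / 2 : ℂ) / (s z + s x), fun z hz => ?_, fun z hz w hw h => ?_,
    fun z hz => ?_⟩
  · rw [mem_ball_zero_iff, norm_div, div_lt_one (norm_pos_iff.mpr (hden z hz))]
    have : ‖(ε / 2 : ℂ)‖ = ε / 2 := by simp [abs_of_pos hε]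
    linarith [hfar z hz]
  · have h1 := mul_left_cancel₀ hε' ((div_eq_div_iff (hden z hz) (hden w hw)).mp h)
    exact hsinj (add_right_cancel h1).symm
  · have h1 := (hasDerivAt_const z (ε / 2 : ℂ)).fun_div ((hsd z hz).hasDerivAt.add_const (s x))
      (hden z hz)
    rw [h1.deriv]
    simp [hsder z hz, hden z hz, hε.ne']

lemma exists_isUnivalentToDisc {U : Set ℂ} (hUo : IsOpen U) (hUc : IsSimplyConnected U)
    (hU : U ≠ univ) {z₀ : ℂ} (hz₀ : z₀ ∈ U) : ∃ f, IsUnivalentToDisc U z₀ f := by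
  obtain ⟨f, hm, hi, hd⟩ := exists_mapsTo_ball_injOn_deriv_ne_zero hUo hUc hU
  have hdiff : ∀ z ∈ U, DifferentiableAt ℂ f z := fun z hz =>
    differentiableAt_of_deriv_ne_zero (hd z hz)
  have hα : ‖f z₀‖ < 1 := mem_ball_zero_iff.mp (hm hz₀)
  have hα' : ‖-f z₀‖ < 1 := by simpa using hα
  refine ⟨mob (f z₀) ∘ f, (mapsTo_mob hα).comp hm, fun z hz w hw h => ?_, fun z hz h => ?_, ?_⟩
  · refine hi hz hw ?_
    have := congrArg (mob (-f z₀)) h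
    simpa only [Function.comp_apply, mob_neg_mob hα (mem_ball_zero_iff.mp (hm hz)),
      mob_neg_mob hα (mem_ball_zero_iff.mp (hm hw))] using this
  · have hfz := hm hz
    have d1 : DifferentiableAt ℂ (mob (f z₀)) (f z) :=
      (differentiableOn_mob hα).differentiableAt (isOpen_ball.mem_nhds hfz)
    have d2 : DifferentiableAt ℂ (mob (-f z₀)) (mob (f z₀) (f z)) :=
      (differentiableOn_mob hα').differentiableAt (isOpen_ball.mem_nhds (mapsTo_mob hα hfz))
    have heq : mob (-f z₀) ∘ (mob (f z₀) ∘ f) =ᶠ[𝓝 z] f := by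
      filter_upwards [hUo.mem_nhds hz] with w hw
      exact mob_neg_mob hα (mem_ball_zero_iff.mp (hm hw))
    apply hd z hz
    rw [← heq.deriv_eq, deriv_comp z d2 (d1.comp z (hdiff z hz)), h, mul_zero]
  · exact mob_self _

lemma norm_deriv_le_of_isUnivalentToDisc {U : Set ℂ} {z₀ : ℂ} {R : ℝ} (hR : 0 < R)
    (hRU : ball z₀ R ⊆ U) {f : ℂ → ℂ} (hf : IsUnivalentToDisc U z₀ f) :
    ‖deriv f z₀‖ ≤ 1 / R :=
  norm_deriv_le_div_of_mapsTo_ball (hf.differentiableOn.mono hRU)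
    (by rw [hf.map_base]; exact (hf.mapsTo.mono_left hRU).mono_right ball_subset_closedBall) hR

/-- A locally uniform limit of univalent maps to the disc is univalent if it has a non-zero
derivative at the base point. -/
lemma isUnivalentToDisc_of_tendsto {ι : Type*} {l : Filter ι} [l.NeBot] {U : Set ℂ}
    (hU : IsOpen U) (hUc : IsPreconnected U) {z₀ : ℂ} (hz₀ : z₀ ∈ U) {f : ι → ℂ → ℂ} {g : ℂ → ℂ}
    (hf : ∀ i, IsUnivalentToDisc U z₀ (f i)) (hfg : TendstoLocallyUniformlyOn f g l U)
    (hg : deriv g z₀ ≠ 0) : IsUnivalentToDisc U z₀ g := by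
  have hfd : ∀ i, DifferentiableOn ℂ (f i) U := fun i => (hf i).differentiableOn
  have hgd : DifferentiableOn ℂ g U := hfg.differentiableOn (Eventually.of_forall hfd) hU
  have hga : AnalyticOnNhd ℂ g U := hgd.analyticOnNhd hU
  have hnc : ∀ c, ¬ EqOn g (fun _ => c) U := by
    intro c hc
    apply hg
    rw [(hc.eventuallyEq_of_mem (hU.mem_nhds hz₀)).deriv_eq, deriv_const]
  have hcl : MapsTo g U (closedBall 0 1) := fun z hz =>
    isClosed_closedBall.mem_of_tendsto (hfg.tendsto_at hz)
      (Eventually.of_forall fun i => ball_subset_closedBall ((hf i).mapsTo hz))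
  refine ⟨?_, ?_, ?_, ?_⟩
  -- The limit takes values in the closed disc; the open mapping theorem pushes them into its
  -- interior.
  · rcases hga.is_constant_or_isOpen hUc with ⟨c, hc⟩ | ho
    · exact absurd hc (hnc c)
    · rw [mapsTo_iff_image_subset, ← interior_closedBall (0 : ℂ) one_ne_zero]
      exact (ho U subset_rfl hU).subset_interior_iff.mpr (mapsTo_iff_image_subset.mp hcl)
  · intro a ha b hb hab
    by_contra hne
    -- Off `a` the functions `f i - f i a` have no zeros, so by Hurwitz their limit `g - g a` cannot
    -- vanish at `b`.
    have hU' : IsOpen (U \ {a}) := hU.sdiff isClosed_singleton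
    have hlim : TendstoLocallyUniformlyOn (fun i z => f i z - f i a) (fun z => g z - g a) l
        (U \ {a}) := by
      refine (hfg.mono sdiff_subset).sub ?_
      refine (TendstoUniformlyOn.tendstoLocallyUniformlyOn ?_)
      rw [Metric.tendstoUniformlyOn_iff]
      intro ε hε
      filter_upwards [Metric.tendsto_nhds.mp (hfg.tendsto_at ha) ε hε] with i hi x _
      rwa [dist_comm]
    have hba : b ∈ U \ {a} := ⟨hb, fun h => hne h.symm⟩
    have hev : ∀ᶠ z in 𝓝[≠] b, g z - g a ≠ 0 := by
      rcases ((hga b hb).sub analyticAt_const).eventually_eq_zero_or_eventually_ne_zero with h | h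
      · refine absurd (hga.eqOn_of_preconnected_of_eventuallyEq analyticOnNhd_const hUc hb ?_)
          (hnc (g a))
        exact h.mono fun z hz => sub_eq_zero.mp hz
      · exact h
    obtain ⟨i, z, hz, hfz⟩ := (eventually_exists_zero hU'
      (fun i => ((hfd i).mono sdiff_subset).sub_const _)
      ((hgd.continuousOn.mono sdiff_subset).sub continuousOn_const) hlim hba
      (by simp [hab]) hev).exists
    exact hz.2 ((hf i).injOn hz.1 ha (sub_eq_zero.mp hfz))
  · intro z hz h0
    have hda : AnalyticOnNhd ℂ (deriv g) U := hga.deriv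
    have hev : ∀ᶠ w in 𝓝[≠] z, deriv g w ≠ 0 := by
      rcases (hda z hz).eventually_eq_zero_or_eventually_ne_zero with h | h
      · exact absurd (hda.eqOn_zero_of_preconnected_of_eventuallyEq_zero hUc hz h hz₀) hg
      · exact h
    obtain ⟨i, w, hw, hfw⟩ := (eventually_exists_zero hU
      (f := deriv ∘ f) (fun i => ((hfd i).deriv hU))
      hda.continuousOn (hfg.deriv (Eventually.of_forall hfd) hU) hz h0 hev).exists
    exact (hf i).deriv_ne_zero w hw hfw
  · refine tendsto_nhds_unique (hfg.tendsto_at hz₀) ?_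
    simp only [(hf _).map_base]
    exact tendsto_const_nhds

/-- Montel gives a limit of a maximising sequence. Its derivative at `z₀` is nonzero because some
competitor has a nonzero one, so the limit is univalent. -/
lemma exists_isUnivalentToDisc_maximal {U : Set ℂ} (hUo : IsOpen U) (hUc : IsSimplyConnected U)
    (hU : U ≠ univ) {z₀ : ℂ} (hz₀ : z₀ ∈ U) :
    ∃ g, IsUnivalentToDisc U z₀ g ∧ ∀ f, IsUnivalentToDisc U z₀ f →
      ‖deriv f z₀‖ ≤ ‖deriv g z₀‖ := by
  obtain ⟨R, hR, hRU⟩ := Metric.isOpen_iff.mp hUo z₀ hz₀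
  set S : Set ℝ := (fun f : ℂ → ℂ => ‖deriv f z₀‖) '' {f | IsUnivalentToDisc U z₀ f}
  have hbdd : BddAbove S := by
    refine ⟨1 / R, ?_⟩
    rintro _ ⟨f, hf, rfl⟩
    exact norm_deriv_le_of_isUnivalentToDisc hR hRU hf
  obtain ⟨f₀, hf₀⟩ := exists_isUnivalentToDisc hUo hUc hU hz₀
  have hne : S.Nonempty := ⟨_, f₀, hf₀, rfl⟩
  obtain ⟨u, -, hu, huS⟩ := exists_seq_tendsto_sSup hne hbdd
  choose f hf hfu using huS
  obtain ⟨g, hg⟩ := exists_tendstoLocallyUniformlyOn (Filter.hyperfilter ℕ) hUo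
    (fun i => (hf i).differentiableOn) (fun i => (hf i).mapsTo.mono_right ball_subset_closedBall)
  have hder : ‖deriv g z₀‖ = sSup S := by
    have h1 := ((hg.deriv (Eventually.of_forall fun i => (hf i).differentiableOn)
      hUo).tendsto_at hz₀).norm
    refine tendsto_nhds_unique h1 ?_
    simpa only [Function.comp_apply, hfu] using hu.mono_left Nat.hyperfilter_le_atTop
  have hle : ∀ f, IsUnivalentToDisc U z₀ f → ‖deriv f z₀‖ ≤ ‖deriv g z₀‖ := fun f hf => by
    rw [hder]
    exact le_csSup hbdd ⟨f, hf, rfl⟩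
  refine ⟨g, isUnivalentToDisc_of_tendsto hUo hUc.isPathConnected.isConnected.isPreconnected hz₀
    hf hg (norm_pos_iff.mp ?_), hle⟩
  exact (norm_pos_iff.mpr (hf₀.deriv_ne_zero z₀ hz₀)).trans_le (hle f₀ hf₀)

/-- Equality in the Schwarz lemma would make `ψ` a rotation, which is injective. -/
lemma norm_deriv_lt_one_of_not_injOn {ψ : ℂ → ℂ} (hd : DifferentiableOn ℂ ψ (ball 0 1))
    (hm : MapsTo ψ (ball 0 1) (ball 0 1)) (h0 : ψ 0 = 0) (hi : ¬ InjOn ψ (ball 0 1)) :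
    ‖deriv ψ 0‖ < 1 := by
  have hm' : MapsTo ψ (ball 0 1) (closedBall (ψ 0) 1) := by
    rw [h0]; exact hm.mono_right ball_subset_closedBall
  refine lt_of_le_of_ne (norm_deriv_le_one_of_mapsTo_ball hd hm' one_pos) fun h => hi ?_
  have haff := affine_of_mapsTo_ball_of_norm_dslope_eq_div hd hm' (mem_ball_self one_pos)
    (by rw [dslope_same, h, div_one])
  intro x hx y hy hxy
  rw [haff hx, haff hy, h0, dslope_same] at hxy
  have hne : deriv ψ 0 ≠ 0 := norm_ne_zero_iff.mp (by rw [h]; exact one_ne_zero)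
  simpa [hne] using hxy

/-- Koebe's argument: if `α` is omitted, `mob α ∘ g` has a square root. Renormalising it gives a
competitor `k` with `g = ψ ∘ k`, where `ψ` involves squaring and is not injective. Thus `‖deriv ψ 0‖
< 1`, and `k` beats `g`. -/
lemma surjOn_of_maximal {U : Set ℂ} (hUo : IsOpen U) (hUc : IsSimplyConnected U)
    {z₀ : ℂ} (hz₀ : z₀ ∈ U) {g : ℂ → ℂ} (hg : IsUnivalentToDisc U z₀ g)
    (hmax : ∀ f, IsUnivalentToDisc U z₀ f → ‖deriv f z₀‖ ≤ ‖deriv g z₀‖) :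
    SurjOn g U (ball 0 1) := by
  intro α hα
  by_contra hαU
  have hα1 : ‖α‖ < 1 := mem_ball_zero_iff.mp hα
  have hα1' : ‖-α‖ < 1 := by simpa using hα1
  have hgd := hg.differentiableOn
  have hhd : DifferentiableOn ℂ (mob α ∘ g) U := (differentiableOn_mob hα1).comp hgd hg.mapsTo
  have hh0 : ∀ z ∈ U, mob α (g z) ≠ 0 := by
    intro z hz h
    apply hαU
    refine ⟨z, hz, ?_⟩
    rw [← mob_neg_mob hα1 (mem_ball_zero_iff.mp (hg.mapsTo hz)), h, mob_zero_right, neg_neg]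
  obtain ⟨s, hsc, hsq⟩ := exists_continuousOn_pow_eq hUc hUo hhd.continuousOn
    (by rintro ⟨z, hz, h⟩; exact hh0 z hz h) two_ne_zero
  have hsd : DifferentiableOn ℂ s U := fun z hz =>
    (differentiableAt_of_sq_eq hUo hsc (fun w _ => hsq w) hz (hh0 z hz)
      (hhd.differentiableAt (hUo.mem_nhds hz))).differentiableWithinAt
  have hsm : MapsTo s U (ball 0 1) := by
    intro z hz
    rw [mem_ball_zero_iff, ← pow_lt_one_iff_of_nonneg (norm_nonneg _) two_ne_zero, ← norm_pow, hsq]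
    exact norm_mob_lt_one hα1 (mem_ball_zero_iff.mp (hg.mapsTo hz))
  set β := s z₀
  have hβ1 : ‖β‖ < 1 := mem_ball_zero_iff.mp (hsm hz₀)
  have hβ1' : ‖-β‖ < 1 := by simpa using hβ1
  set k := mob β ∘ s
  have hkd : DifferentiableOn ℂ k U := (differentiableOn_mob hβ1).comp hsd hsm
  have hkm : MapsTo k U (ball 0 1) := (mapsTo_mob hβ1).comp hsm
  have hk0 : k z₀ = 0 := mob_self _
  set q : ℂ → ℂ := fun w => w ^ 2
  have hqm : MapsTo q (ball 0 1) (ball 0 1) := by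
    intro w hw
    rw [mem_ball_zero_iff] at *
    simpa [q] using pow_lt_one₀ (norm_nonneg w) hw two_ne_zero
  have hqd : DifferentiableOn ℂ q (ball 0 1) := by fun_prop
  set ψ := mob (-α) ∘ (q ∘ mob (-β))
  have hψd : DifferentiableOn ℂ ψ (ball 0 1) := (differentiableOn_mob hα1').comp
    (hqd.comp (differentiableOn_mob hβ1') (mapsTo_mob hβ1')) (hqm.comp (mapsTo_mob hβ1'))
  have hψm : MapsTo ψ (ball 0 1) (ball 0 1) :=
    (mapsTo_mob hα1').comp (hqm.comp (mapsTo_mob hβ1'))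
  have hψk : ∀ z ∈ U, ψ (k z) = g z := by
    intro z hz
    simp only [ψ, k, q, Function.comp_apply, mob_neg_mob hβ1 (mem_ball_zero_iff.mp (hsm hz)), hsq,
      mob_neg_mob hα1 (mem_ball_zero_iff.mp (hg.mapsTo hz))]
  have hψ0 : ψ 0 = 0 := by rw [← hk0, hψk z₀ hz₀, hg.map_base, hk0]
  have hderiv : ∀ z ∈ U, deriv g z = deriv ψ (k z) * deriv k z := by
    intro z hz
    have heq : ψ ∘ k =ᶠ[𝓝 z] g := by
      filter_upwards [hUo.mem_nhds hz] with w hw using hψk w hw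
    rw [← heq.deriv_eq, deriv_comp z (hψd.differentiableAt (isOpen_ball.mem_nhds (hkm hz)))
      (hkd.differentiableAt (hUo.mem_nhds hz))]
  have hku : IsUnivalentToDisc U z₀ k := by
    refine ⟨hkm, fun z hz w hw h => ?_, fun z hz h => ?_, hk0⟩
    · exact hg.injOn hz hw (by rw [← hψk z hz, ← hψk w hw, h])
    · exact hg.deriv_ne_zero z hz (by rw [hderiv z hz, h, mul_zero])
  have hninj : ¬ InjOn ψ (ball 0 1) := by
    intro hi
    have h2 : ‖(1 / 2 : ℂ)‖ < 1 := by norm_num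
    have h2' : ‖-(1 / 2 : ℂ)‖ < 1 := by norm_num
    have := hi (mapsTo_mob hβ1 (mem_ball_zero_iff.mpr h2))
      (mapsTo_mob hβ1 (mem_ball_zero_iff.mpr h2'))
      (by simp only [ψ, q, Function.comp_apply, mob_neg_mob hβ1 h2, mob_neg_mob hβ1 h2', neg_sq])
    have := congrArg (mob (-β)) this
    rw [mob_neg_mob hβ1 h2, mob_neg_mob hβ1 h2'] at this
    norm_num at this
  have hlt := norm_deriv_lt_one_of_not_injOn hψd hψm hψ0 hninj
  have hle := hmax k hku
  rw [hderiv z₀ hz₀, hk0, norm_mul] at hle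
  have hpos : 0 < ‖deriv k z₀‖ := norm_pos_iff.mpr (hku.deriv_ne_zero z₀ hz₀)
  nlinarith

/-- The **Riemann mapping theorem**. -/
theorem exists_biholomorphic_disc {U : Set ℂ} (hUo : IsOpen U) (hUc : IsSimplyConnected U)
    (hU : U ≠ univ) :
    ∃ F G : ℂ → ℂ, DifferentiableOn ℂ F U ∧ MapsTo F U (ball 0 1) ∧
      DifferentiableOn ℂ G (ball 0 1) ∧ MapsTo G (ball 0 1) U ∧
      (∀ z ∈ U, G (F z) = z) ∧ ∀ w ∈ ball (0 : ℂ) 1, F (G w) = w := by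
  obtain ⟨z₀, hz₀⟩ := hUc.nonempty
  obtain ⟨F, hF, hmax⟩ := exists_isUnivalentToDisc_maximal hUo hUc hU hz₀
  have hsurj := surjOn_of_maximal hUo hUc hz₀ hF hmax
  have hGm := hsurj.mapsTo_invFunOn
  have hFG : ∀ w ∈ ball (0 : ℂ) 1, F (Function.invFunOn F U w) = w :=
    fun w hw => hsurj.rightInvOn_invFunOn hw
  have hGF : ∀ z ∈ U, Function.invFunOn F U (F z) = z :=
    fun z hz => hF.injOn.leftInvOn_invFunOn hz
  refine ⟨F, Function.invFunOn F U, hF.differentiableOn, hF.mapsTo, fun w hw => ?_, hGm, hGF, hFG⟩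
  set G := Function.invFunOn F U
  have hz := hGm hw
  have hstrict : HasStrictDerivAt F (deriv F (G w)) (G w) :=
    (hF.differentiableOn.analyticAt (hUo.mem_nhds hz)).hasStrictDerivAt
  have hne := hF.deriv_ne_zero _ hz
  -- `F` maps the neighbourhood filter of `G w` onto that of `w`, and `G` undoes `F` near `G w`.
  have hcont : ContinuousAt G w := by
    have hmap := hstrict.map_nhds_eq hne
    rw [hFG w hw] at hmap
    rw [ContinuousAt, ← hmap, tendsto_map'_iff]
    refine tendsto_id.congr' ?_
    filter_upwards [hUo.mem_nhds hz] with z hz using (hGF z hz).symm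
  exact (hstrict.hasDerivAt.of_local_left_inverse hcont hne
    (by filter_upwards [isOpen_ball.mem_nhds hw] with y hy
        using hFG y hy)).differentiableAt.differentiableWithinAt

/-! ### Absolutely continuous curves and compactness bounds -/

/-- A unimodular factor `c` makes the increment real and non-negative. The fundamental theorem for
the real function `Re (c f)` then suffices, since its derivative is at most `‖f'‖` almost
everywhere. -/
lemma norm_sub_le_integral_norm_deriv {f : ℝ → ℂ} {a b : ℝ} (hab : a ≤ b)
    (hf : AbsolutelyContinuousOnInterval f a b)
    (hi : IntervalIntegrable (fun t => ‖deriv f t‖) volume a b) :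
    ‖f b - f a‖ ≤ ∫ t in a..b, ‖deriv f t‖ := by
  obtain ⟨c, hc, hcn⟩ : ∃ c : ℂ, ‖c‖ = 1 ∧ c * (f b - f a) = ‖f b - f a‖ := by
    by_cases h : f b - f a = 0
    · exact ⟨1, by simp, by simp [h]⟩
    · have hn : (‖f b - f a‖ : ℂ) ≠ 0 := by simpa using h
      exact ⟨‖f b - f a‖ / (f b - f a), by simp [norm_ne_zero_iff.mpr h], div_mul_cancel₀ _ h⟩
  set u : ℝ → ℝ := fun t => (c * f t).re
  have hu : AbsolutelyContinuousOnInterval u a b := by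
    rw [absolutelyContinuousOnInterval_iff] at hf ⊢
    intro ε hε
    obtain ⟨δ, hδ, h⟩ := hf ε hε
    refine ⟨δ, hδ, fun E hE hlt => (Finset.sum_le_sum fun i _ => ?_).trans_lt (h E hE hlt)⟩
    rw [Real.dist_eq, dist_eq_norm, ← Complex.sub_re, ← mul_sub]
    refine (Complex.abs_re_le_norm _).trans ?_
    rw [norm_mul, hc, one_mul]
  have hub : u b - u a = ‖f b - f a‖ := by
    have := congrArg Complex.re hcn
    rwa [Complex.ofReal_re, mul_sub, Complex.sub_re] at this
  rw [← hub, ← hu.integral_deriv_eq_sub]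
  refine intervalIntegral.integral_mono_ae_restrict hab hu.intervalIntegrable_deriv hi ?_
  refine (ae_restrict_iff' measurableSet_Icc).mpr ?_
  filter_upwards [hf.boundedVariationOn.ae_differentiableAt_of_mem_uIcc] with t ht htm
  rw [uIcc_of_le hab] at ht
  have h1 : HasDerivAt u (c * deriv f t).re t := by
    have := (Complex.reCLM.hasFDerivAt.comp_hasDerivAt t ((ht htm).hasDerivAt.const_mul c))
    exact this
  rw [h1.deriv]
  refine (Complex.re_le_norm _).trans ?_
  rw [norm_mul, hc, one_mul]

lemma exists_norm_le_of_isCompact {K : Set ℂ} (hK : IsCompact K) (hsub : K ⊆ ball 0 1) :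
    ∃ r : ℝ, 0 ≤ r ∧ r < 1 ∧ ∀ w ∈ K, ‖w‖ ≤ r := by
  -- Inserting `0` covers the case of empty `K`.
  obtain ⟨x, hx, hmax⟩ := (hK.insert 0).exists_isMaxOn (insert_nonempty _ _)
    continuous_norm.continuousOn
  refine ⟨‖x‖, norm_nonneg _, ?_, fun w hw => hmax (mem_insert_of_mem _ hw)⟩
  exact mem_ball_zero_iff.mp (insert_subset (mem_ball_self one_pos) hsub hx)

lemma exists_lipschitzOnWith_of_isCompact {U K : Set ℂ} (hU : IsOpen U) (hK : IsCompact K)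
    (hKU : K ⊆ U) {F : ℂ → ℂ} (hF : DifferentiableOn ℂ F U) : ∃ L, LipschitzOnWith L F K := by
  refine LocallyLipschitzOn.exists_lipschitzOnWith_of_compact hK fun x hx => ?_
  have hc : ContDiffAt ℂ 1 F x := (hF.analyticAt (hU.mem_nhds (hKU hx))).contDiffAt
  obtain ⟨L, t, ht, hL⟩ := hc.exists_lipschitzOnWith
  exact ⟨L, t, mem_nhdsWithin_of_mem_nhds ht, hL⟩

/-! ### Control by two trajectories -/

/-- On `[0, T]`, the increments of `t ↦ Φ_{s,t}(z)` are controlled by those of two non-colliding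
trajectories. -/
theorem exists_norm_sub_le_of_trajectories {D : Set ℂ} (hDo : IsOpen D)
    (hDsc : IsSimplyConnected D) (hDne : D ≠ univ) {Φ : ℝ → ℝ → ℂ → ℂ}
    (hΦ : IsHolSelfMapFamily D Φ) (h2 : EF2 D Φ) {ζ₁ ζ₂ : ℂ} (hζ₁ : ζ₁ ∈ D) (hζ₂ : ζ₂ ∈ D)
    {T : ℝ} (hT : 0 ≤ T) (hc₁ : ContinuousOn (fun t => Φ 0 t ζ₁) (Icc 0 T))
    (hc₂ : ContinuousOn (fun t => Φ 0 t ζ₂) (Icc 0 T))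
    (hne : ∀ t : ℝ, 0 ≤ t → Φ 0 t ζ₁ ≠ Φ 0 t ζ₂) {z : ℂ} (hz : z ∈ D) :
    ∃ C : ℝ, 0 ≤ C ∧ ∀ s u t : ℝ, 0 ≤ s → s ≤ u → u ≤ t → t ≤ T →
      ‖Φ s t z - Φ s u z‖ ≤
        C * (‖Φ 0 t ζ₁ - Φ 0 u ζ₁‖ + ‖Φ 0 t ζ₂ - Φ 0 u ζ₂‖) := by
  obtain ⟨F, G, hFd, hFm, hGd, hGm, hGF, -⟩ := exists_biholomorphic_disc hDo hDsc hDne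
  set a : ℝ → ℂ := fun t => Φ 0 t ζ₁
  set b : ℝ → ℂ := fun t => Φ 0 t ζ₂
  have haD : ∀ t, 0 ≤ t → a t ∈ D := fun t ht => (hΦ 0 t le_rfl ht).2 hζ₁
  have hbD : ∀ t, 0 ≤ t → b t ∈ D := fun t ht => (hΦ 0 t le_rfl ht).2 hζ₂
  set K : Set ℂ := insert z (a '' Icc 0 T ∪ b '' Icc 0 T)
  have hK : IsCompact K :=
    ((isCompact_Icc.image_of_continuousOn hc₁).union
      (isCompact_Icc.image_of_continuousOn hc₂)).insert z
  have hKD : K ⊆ D := by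
    refine insert_subset hz (union_subset ?_ ?_)
    · rintro _ ⟨t, ht, rfl⟩; exact haD t ht.1
    · rintro _ ⟨t, ht, rfl⟩; exact hbD t ht.1
  have haK : ∀ t ∈ Icc 0 T, a t ∈ K := fun t ht => Or.inr (Or.inl ⟨t, ht, rfl⟩)
  have hbK : ∀ t ∈ Icc 0 T, b t ∈ K := fun t ht => Or.inr (Or.inr ⟨t, ht, rfl⟩)
  have hFc : ContinuousOn F D := hFd.continuousOn
  obtain ⟨r, hr0, hr1, hrK⟩ := exists_norm_le_of_isCompact
    (hK.image_of_continuousOn (hFc.mono hKD)) (hFm.mono_left hKD).image_subset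
  have hr : ∀ x ∈ K, ‖F x‖ ≤ r := fun x hx => hrK _ (mem_image_of_mem F hx)
  obtain ⟨L, hL⟩ := exists_lipschitzOnWith_of_isCompact hDo hK hKD hFd
  -- `F` is injective on `D` and the trajectories do not collide, so this continuous distance has a
  -- positive minimum on `[0, T]`.
  obtain ⟨δ, hδ, hδab⟩ : ∃ δ : ℝ, 0 < δ ∧ ∀ t ∈ Icc 0 T, δ ≤ ‖F (b t) - F (a t)‖ := by
    have hcont : ContinuousOn (fun t => ‖F (b t) - F (a t)‖) (Icc 0 T) :=
      ((hFc.comp hc₂ fun t ht => hbD t ht.1).sub (hFc.comp hc₁ fun t ht => haD t ht.1)).norm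
    obtain ⟨x, hx, hmin⟩ := isCompact_Icc.exists_isMinOn (nonempty_Icc.mpr hT) hcont
    refine ⟨_, norm_pos_iff.mpr fun h => hne x hx.1 ?_, fun t ht => hmin ht⟩
    have := congrArg G (sub_eq_zero.mp h)
    rw [hGF _ (hbD x hx.1), hGF _ (haD x hx.1)] at this
    exact this.symm
  obtain ⟨ρ, hrρ, hρ1, hbound⟩ := exists_norm_map_le hr0 hr1
  obtain ⟨C, hC, hest⟩ := exists_norm_map_sub_le (hr0.trans hrρ) hρ1 hδ
  obtain ⟨M, hM⟩ := exists_lipschitzOnWith_of_isCompact isOpen_ball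
    (isCompact_closedBall (0 : ℂ) ρ) (closedBall_subset_ball hρ1) hGd
  have hψd : ∀ s t, 0 ≤ s → s ≤ t → DifferentiableOn ℂ (F ∘ Φ s t ∘ G) (ball 0 1) :=
    fun s t hs hst => hFd.comp ((hΦ s t hs hst).1.comp hGd hGm) ((hΦ s t hs hst).2.comp hGm)
  have hψm : ∀ s t, 0 ≤ s → s ≤ t → MapsTo (F ∘ Φ s t ∘ G) (ball 0 1) (ball 0 1) :=
    fun s t hs hst => hFm.comp ((hΦ s t hs hst).2.comp hGm)
  have hψF : ∀ s t, ∀ x ∈ D, (F ∘ Φ s t ∘ G) (F x) = F (Φ s t x) := fun s t x hx => by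
    simp only [Function.comp_apply, hGF x hx]
  have hψa : ∀ s t, 0 ≤ s → s ≤ t → (F ∘ Φ s t ∘ G) (F (a s)) = F (a t) := fun s t hs hst => by
    rw [hψF s t _ (haD s hs)]
    exact congrArg F (h2 0 s t le_rfl hs hst _ hζ₁).symm
  have hψb : ∀ s t, 0 ≤ s → s ≤ t → (F ∘ Φ s t ∘ G) (F (b s)) = F (b t) := fun s t hs hst => by
    rw [hψF s t _ (hbD s hs)]
    exact congrArg F (h2 0 s t le_rfl hs hst _ hζ₂).symm
  -- The trajectory of `ζ₁` is the anchor: the conjugated map sends `F (a s)` to `F (a u)`, both of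
  -- norm at most `r`.
  have hΦρ : ∀ s u, 0 ≤ s → s ≤ u → u ≤ T → ‖F (Φ s u z)‖ ≤ ρ := by
    intro s u hs hsu hu
    rw [← hψF s u z hz]
    refine hbound _ (hψd s u hs hsu) (hψm s u hs hsu) (F (a s)) (F z)
      (hr _ (haK s ⟨hs, hsu.trans hu⟩)) ?_ (hr _ (mem_insert _ _))
    rw [hψa s u hs hsu]
    exact hr _ (haK u ⟨hs.trans hsu, hu⟩)
  -- `L` is the Lipschitz constant of `F` on `K`, `C` comes from the displacement estimate in the
  -- disc, and `M` is the Lipschitz constant of `G` on the disc of radius `ρ`.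
  refine ⟨M * (C * L), by positivity, fun s u t hs hsu hut htT => ?_⟩
  have hu0 := hs.trans hsu
  have huT := hut.trans htT
  have hsu' : Φ s u z ∈ D := (hΦ s u hs hsu).2 hz
  have hst' : Φ s t z ∈ D := (hΦ s t hs (hsu.trans hut)).2 hz
  have huI : u ∈ Icc 0 T := ⟨hu0, huT⟩
  have htI : t ∈ Icc 0 T := ⟨hu0.trans hut, htT⟩
  have h1 : ‖F (Φ s t z) - F (Φ s u z)‖ ≤
      C * (‖F (a t) - F (a u)‖ + ‖F (b t) - F (b u)‖) := by
    have := hest _ (hψd u t hu0 hut) (hψm u t hu0 hut) (F (a u)) (F (b u)) (F (Φ s u z))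
      ((hr _ (haK u huI)).trans hrρ) ((hr _ (hbK u huI)).trans hrρ) (hΦρ s u hs hsu huT)
      (by rw [hψa u t hu0 hut]; exact (hr _ (haK t htI)).trans hrρ)
      (by rw [hψb u t hu0 hut]; exact (hr _ (hbK t htI)).trans hrρ) (hδab u huI)
    rwa [hψa u t hu0 hut, hψb u t hu0 hut, hψF u t _ hsu', ← h2 s u t hs hsu hut z hz] at this
  have h3 : ‖Φ s t z - Φ s u z‖ ≤ M * ‖F (Φ s t z) - F (Φ s u z)‖ := by
    have := hM.dist_le_mul _ (mem_closedBall_zero_iff.mpr (hΦρ s t hs (hsu.trans hut) htT)) _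
      (mem_closedBall_zero_iff.mpr (hΦρ s u hs hsu huT))
    rwa [hGF _ hst', hGF _ hsu', dist_eq_norm, dist_eq_norm] at this
  have h4 : ‖F (a t) - F (a u)‖ ≤ L * ‖a t - a u‖ := by
    simpa only [dist_eq_norm] using hL.dist_le_mul _ (haK t htI) _ (haK u huI)
  have h5 : ‖F (b t) - F (b u)‖ ≤ L * ‖b t - b u‖ := by
    simpa only [dist_eq_norm] using hL.dist_le_mul _ (hbK t htI) _ (hbK u huI)
  calc ‖Φ s t z - Φ s u z‖ ≤ M * (C * (L * ‖a t - a u‖ + L * ‖b t - b u‖)) := by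
        refine h3.trans (mul_le_mul_of_nonneg_left (h1.trans ?_) M.2)
        gcongr
    _ = M * (C * L) * (‖a t - a u‖ + ‖b t - b u‖) := by ring

end Loewner

/-! ### Conclusion: EF3 -/

theorem proposition3p9 (d : ℝ≥0∞) (hd : 1 ≤ d)
    (D : Set ℂ) (hDo : IsOpen D) (hDsc : IsSimplyConnected D) (hDne : D ≠ Set.univ)
    (Φ : ℝ → ℝ → ℂ → ℂ) (hΦ : Loewner.IsHolSelfMapFamily D Φ)
    (h1 : Loewner.EF1 D Φ) (h2 : Loewner.EF2 D Φ)
    (ζ₁ ζ₂ : ℂ) (hζ₁ : ζ₁ ∈ D) (hζ₂ : ζ₂ ∈ D) (hζ : ζ₁ ≠ ζ₂)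
    (hac₁ : Loewner.MemAC d (Set.Ici 0) D (fun t => Φ 0 t ζ₁))
    (hac₂ : Loewner.MemAC d (Set.Ici 0) D (fun t => Φ 0 t ζ₂))
    (hne : ∀ t : ℝ, 0 ≤ t → Φ 0 t ζ₁ ≠ Φ 0 t ζ₂) :
    Loewner.IsEvolutionFamily d D Φ := by
  refine ⟨hΦ, h1, h2, fun T hT z hz => ?_⟩
  have hcont : ∀ ζ, Loewner.MemAC d (Set.Ici 0) D (fun t => Φ 0 t ζ) →
      ContinuousOn (fun t => Φ 0 t ζ) (Icc 0 T) := fun ζ h => by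
    simpa only [uIcc_of_le hT.le] using
      (h.absolutelyContinuous 0 T hT.le Icc_subset_Ici_self).continuousOn
  obtain ⟨C, hC, hest⟩ := Loewner.exists_norm_sub_le_of_trajectories hDo hDsc hDne hΦ h2 hζ₁ hζ₂
    hT.le (hcont ζ₁ hac₁) (hcont ζ₂ hac₂) hne hz
  have hint : ∀ ζ, Loewner.MemAC d (Set.Ici 0) D (fun t => Φ 0 t ζ) → ∀ u t, 0 ≤ u → u ≤ t →
      IntervalIntegrable (fun ξ => ‖deriv (fun t => Φ 0 t ζ) ξ‖) volume u t ∧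
      ‖Φ 0 t ζ - Φ 0 u ζ‖ ≤ ∫ ξ in u..t, ‖deriv (fun t => Φ 0 t ζ) ξ‖ := fun ζ h u t hu hut => by
    have hsub : Icc u t ⊆ Ici 0 := Icc_subset_Ici_iff hut |>.mpr hu
    have hi : IntervalIntegrable (fun ξ => ‖deriv (fun t => Φ 0 t ζ) ξ‖) volume u t :=
      -- Since `1 ≤ d`, an `L^d` function on a compact interval is integrable.
      (intervalIntegrable_iff_integrableOn_Icc_of_le hut).mpr
        ((h.memLp_deriv u t hut hsub).integrable hd).norm
    exact ⟨hi, Loewner.norm_sub_le_integral_norm_deriv hut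
      (h.absolutelyContinuous u t hut hsub) hi⟩
  refine ⟨fun ξ => C * (‖deriv (fun t => Φ 0 t ζ₁) ξ‖ + ‖deriv (fun t => Φ 0 t ζ₂) ξ‖),
    fun ξ _ => by positivity, ?_, fun s u t hs hsu hut htT => ?_⟩
  · exact ((hac₁.memLp_deriv 0 T hT.le Icc_subset_Ici_self).norm.add
      (hac₂.memLp_deriv 0 T hT.le Icc_subset_Ici_self).norm).const_mul C
  · obtain ⟨i₁, e₁⟩ := hint ζ₁ hac₁ u t (hs.trans hsu) hut
    obtain ⟨i₂, e₂⟩ := hint ζ₂ hac₂ u t (hs.trans hsu) hut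
    rw [intervalIntegral.integral_const_mul, intervalIntegral.integral_add i₁ i₂]
    exact (hest s u t hs hsu hut htT).trans (by gcongr)
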